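/- There is an absolute constant $c>0$ such that for every integer $n\ge 3$ there is a finitely supported probability distribution $\mathcal D$ over additive valuations on $n$ items, all of whose types have totally ordered item values $0\le v_1\le v_2\le\cdots\le v_n$, for which $$\mathrm{SubAddRev}(\mathcal D)\;\ge\; c\,\log\log n\cdot \mathrm{SRev}(\mathcal D),\qquad 0<\mathrm{SRev}(\mathcal D),\qquad \mathrm{SubAddRev}(\mathcal D)<\infty .$$ Here a pricing is a function $p:2^{[n]}\to\mathbb R_{\ge 0}$; a buyer of type $v$ (with $v(S)=\sum_{i\in S}v_i$) buys a set $S$ maximizing $v(S)-p(S)$, ties being broken in favour of the highest price, and pays $p(S)$; the revenue of $p$ is the expected payment when $v\sim\mathcal D$. $\mathrm{SubAddRev}(\mathcal D)$ is the supremum of the revenue over all deterministic buy-many mechanisms, i.e. over all monotone pricings with $p(\emptyset)=0$ and $p(S\cup T)\le p(S)+p(T)$ for all $S,T\subseteq[n]$, and $\mathrm{SRev}(\mathcal D)$ is the supremum of the revenue over all item pricings, i.e. pricings of the form $p(S)=\sum_{i\in S}q_i$ with $q_i\ge 0$. In particular, for additive buyers with totally ordered item values, item pricing does not achieve an approximation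 ratio $o(\log\log n)$ to the optimal deterministic buy-many revenue. -/

import Mathlib

open scoped NNReal ENNReal

namespace BuyMany

/-- A valuation over the items `Fin n`: a nonnegative value for every set of items. -/
abbrev SetValuation (n : ℕ) : Type := Finset (Fin n) → ℝ≥0

/-- The deterministic mechanisms: a nonnegative price for every set of items. -/
abbrev Pricing (n : ℕ) : Type := Finset (Fin n) → ℝ≥0

/-- A buyer type is additive if the value of a set is the sum of the values of its items. -/
def IsAdditive {n : ℕ} (v : SetValuation n) : Prop :=
  ∀ S : Finset (Fin n), v S = ∑ i ∈ S, v {i}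

/-- Totally ordered item values: `v₁ ≤ v₂ ≤ ⋯ ≤ vₙ`. -/
def HasOrderedValues {n : ℕ} (v : SetValuation n) : Prop :=
  ∀ i j : Fin n, i ≤ j → v {i} ≤ v {j}

/-- The deterministic buy-many mechanisms, that is, the monotone subadditive pricings; buying
nothing costs nothing. -/
structure IsBuyManyPricing {n : ℕ} (p : Pricing n) : Prop where
  empty : p ∅ = 0
  mono : ∀ S T : Finset (Fin n), S ⊆ T → p S ≤ p T
  subadd : ∀ S T : Finset (Fin n), p (S ∪ T) ≤ p S + p T

/-- Item pricings: every item has a price and a set costs the sum of the prices of its items. -/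
def IsItemPricing {n : ℕ} (p : Pricing n) : Prop :=
  ∃ q : Fin n → ℝ≥0, ∀ S : Finset (Fin n), p S = ∑ i ∈ S, q i

/-- The set `S` maximizes the utility `v T - p T` of a buyer of type `v`. -/
def IsDemanded {n : ℕ} (p : Pricing n) (v : SetValuation n) (S : Finset (Fin n)) : Prop :=
  ∀ T : Finset (Fin n), (v T : ℝ) - (p T : ℝ) ≤ (v S : ℝ) - (p S : ℝ)

open Classical in
/-- The payment of a buyer of type `v`: the price of a utility-maximizing set, where ties are
broken in favour of the most expensive one. -/
noncomputable def payment {n : ℕ} (p : Pricing n) (v : SetValuation n) : ℝ≥0 :=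
  (Finset.univ.filter (IsDemanded p v)).sup p

/-- The expected payment of a buyer whose type is drawn from `D`. -/
noncomputable def revenue {n : ℕ} (p : Pricing n) (D : PMF (SetValuation n)) : ℝ≥0∞ :=
  ∑' v, D v * (payment p v : ℝ≥0∞)

/-- The optimal revenue of deterministic buy-many mechanisms. -/
noncomputable def buyManyRev {n : ℕ} (D : PMF (SetValuation n)) : ℝ≥0∞ :=
  ⨆ (p : Pricing n) (_ : IsBuyManyPricing p), revenue p D

/-- The optimal revenue of item pricings. -/
noncomputable def itemRev {n : ℕ} (D : PMF (SetValuation n)) : ℝ≥0∞ :=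
  ⨆ (p : Pricing n) (_ : IsItemPricing p), revenue p D

/-- There is always a demanded set, and the payment is the price of one of them. -/
theorem exists_isDemanded_payment {n : ℕ} (p : Pricing n) (v : SetValuation n) :
    ∃ S, IsDemanded p v S ∧ payment p v = p S := by
  classical
  obtain ⟨S, -, hS⟩ := Finset.exists_max_image (Finset.univ : Finset (Finset (Fin n)))
    (fun T => (v T : ℝ) - (p T : ℝ)) Finset.univ_nonempty
  obtain ⟨T, hT, h⟩ := Finset.exists_mem_eq_sup (Finset.univ.filter (IsDemanded p v))
    ⟨S, by simpa [IsDemanded] using hS⟩ p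
  refine ⟨T, (Finset.mem_filter.mp hT).2, ?_⟩
  rw [← h, payment]

/-- For a monotone pricing, the other two conditions amount to the buy-many
constraint: every sequence of purchases is dominated by a single menu option that contains the
union of the purchased sets and is at most as expensive. -/
theorem isBuyManyPricing_iff {n : ℕ} (p : Pricing n)
    (hp : ∀ S T : Finset (Fin n), S ⊆ T → p S ≤ p T) :
    IsBuyManyPricing p ↔ ∀ L : List (Finset (Fin n)),
      ∃ T, L.foldr (· ∪ ·) ∅ ⊆ T ∧ p T ≤ (L.map p).sum := by
  constructor
  · intro h L
    refine ⟨_, subset_rfl, ?_⟩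
    induction L with
    | nil => simp [h.empty]
    | cons S L ih =>
      simp only [List.foldr_cons, List.map_cons, List.sum_cons]
      exact (h.subadd _ _).trans (by gcongr)
  · intro h
    refine ⟨?_, hp, fun S T => ?_⟩
    · obtain ⟨T, -, hT⟩ := h []
      exact le_antisymm ((hp ∅ T (Finset.empty_subset _)).trans (by simpa using hT)) zero_le
    · obtain ⟨U, hU, hU'⟩ := h [S, T]
      exact (hp _ U (by simpa using hU)).trans (by simpa using hU')

end BuyMany

/-!
Item pricing sells the items separately, so its revenue is the sum over the items of the best
single-price revenue (`payment_of_additive`). It is compared with the mechanism that sells only the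
grand bundle, at a price that every type in the support is willing to pay.

Let `L = ⌊log₂ n⌋` and rank the items from the most valuable (rank `1`) downwards. A type is given
by a uniform `ω : Fin L`. For every level `l : Fin L` put
`levelValue ω l = 2⁻ˡ / (1 + (ω + l))`, the sum `ω + l` being taken modulo `L`, and let the item of
rank `r` have the value `max {levelValue ω l | r < 2 ^ (l + 1)}`. The maximum makes the values
monotone in the rank.

* The `2 ^ l` items of rank in `[2 ^ l, 2 ^ (l + 1))` have value at least `levelValue ω l`, so the
  grand bundle is worth at least `∑ l, 1 / (1 + (ω + l))`. The cyclic shift permutes the summands,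
  so this is the harmonic number `H_L ≥ log (L + 1) ≥ log log n` for every single `ω`
  (`harmonic_le_sum_itemValue`).
* For fixed `l`, the value `levelValue ω l` is a truncated equal-revenue distribution: at any price
  it earns at most `2⁻ˡ / L` in expectation (`mul_card_levelValue_le`). By a union bound over the
  levels, an item of rank `r` earns at most `∑ 2⁻ˡ / L` over the levels with `r < 2 ^ (l + 1)`.
  Level `l` occurs for fewer than `2 ^ (l + 1)` items, so all items together earn at most `2`
  (`itemRev_le_two`).

Hence the ratio of the two revenues is at least `log log n / 2`.
-/

namespace BuyMany

open Finset

/-! ### Payments under item pricings and bundle pricings -/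

/-- An additive buyer facing item prices `q` pays for exactly the items with `q i ≤ v i`; those with
equality are bought because ties are broken in favour of the higher payment. -/
theorem payment_of_additive {n : ℕ} {v : SetValuation n} (hv : IsAdditive v) (q : Fin n → ℝ≥0) :
    payment (fun S => ∑ i ∈ S, q i) v = ∑ i with q i ≤ v {i}, q i := by
  classical
  have utility (S : Finset (Fin n)) :
      (v S : ℝ) - ((∑ i ∈ S, q i : ℝ≥0) : ℝ) = ∑ i ∈ S, ((v {i} : ℝ) - q i) := by
    rw [hv S]
    push_cast
    rw [Finset.sum_sub_distrib]
  apply le_antisymm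
  · refine Finset.sup_le fun S hS => Finset.sum_le_sum_of_subset fun i hi => ?_
    have hd : IsDemanded _ v S := (Finset.mem_filter.mp hS).2
    have h := hd (S.erase i)
    rw [utility, utility, ← Finset.add_sum_erase S _ hi] at h
    have : (q i : ℝ) ≤ v {i} := by linarith
    simpa using this
  · refine Finset.le_sup (f := fun S : Finset (Fin n) => ∑ i ∈ S, q i) ?_
    simp only [Finset.mem_filter, Finset.mem_univ, true_and]
    intro T
    rw [utility, utility]
    calc ∑ i ∈ T, ((v {i} : ℝ) - q i) ≤ ∑ i ∈ T, max ((v {i} : ℝ) - q i) 0 :=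
          Finset.sum_le_sum fun i _ => le_max_left _ _
      _ ≤ ∑ i, max ((v {i} : ℝ) - q i) 0 :=
          Finset.sum_le_sum_of_subset_of_nonneg (Finset.subset_univ T)
            fun i _ _ => le_max_right _ _
      _ = ∑ i with q i ≤ v {i}, ((v {i} : ℝ) - q i) := by
          rw [Finset.sum_filter]
          refine Finset.sum_congr rfl fun i _ => ?_
          split_ifs with h
          · exact max_eq_left (sub_nonneg.mpr (by exact_mod_cast h))
          · exact max_eq_right (sub_nonpos.mpr (by exact_mod_cast (not_le.mp h).le))

/-- The pricing that sells every nonempty set at the same price `P`. -/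
noncomputable def bundlePricing (n : ℕ) (P : ℝ≥0) : Pricing n :=
  fun S => if S = ∅ then 0 else P

theorem isBuyManyPricing_bundlePricing (n : ℕ) (P : ℝ≥0) :
    IsBuyManyPricing (bundlePricing n P) where
  empty := by simp [bundlePricing]
  mono S T h := by
    unfold bundlePricing
    split_ifs with hS hT
    · exact le_rfl
    · exact zero_le
    · exact absurd (Finset.subset_empty.mp (‹T = ∅› ▸ h)) hS
    · exact le_rfl
  subadd S T := by
    unfold bundlePricing
    by_cases hS : S = ∅ <;> by_cases hT : T = ∅ <;> simp [hS, hT, Finset.union_eq_empty]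

theorem le_payment_bundlePricing {n : ℕ} (hn : 0 < n) {v : SetValuation n} (hv : IsAdditive v)
    {P : ℝ≥0} (hP : P ≤ v univ) : P ≤ payment (bundlePricing n P) v := by
  have hne : (univ : Finset (Fin n)) ≠ ∅ :=
    Finset.nonempty_iff_ne_empty.mp ⟨⟨0, hn⟩, Finset.mem_univ _⟩
  have huniv : bundlePricing n P univ = P := by simp only [bundlePricing, if_neg hne]
  have hdem : IsDemanded (bundlePricing n P) v univ := by
    intro T
    rw [huniv]
    have hP' : (P : ℝ) ≤ v univ := by exact_mod_cast hP
    by_cases hT : T = ∅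
    · subst hT
      simpa [bundlePricing, hv ∅] using hP'
    · have hle : v T ≤ v univ := by
        rw [hv T, hv univ]
        exact Finset.sum_le_sum_of_subset (Finset.subset_univ T)
      simp only [bundlePricing, if_neg hT]
      gcongr
  classical
  calc P = bundlePricing n P univ := huniv.symm
    _ ≤ _ := Finset.le_sup (f := bundlePricing n P)
      (Finset.mem_filter.mpr ⟨Finset.mem_univ _, hdem⟩)

/-- No buyer pays more than the value of the purchased set. -/
theorem payment_le_value {n : ℕ} {p : Pricing n} (hp : p ∅ = 0) {v : SetValuation n}
    (hv : IsAdditive v) : payment p v ≤ v univ := by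
  obtain ⟨S, hS, h⟩ := exists_isDemanded_payment p v
  have h0 := hS ∅
  rw [hp, hv ∅] at h0
  have hpS : p S ≤ v S := by
    rw [← NNReal.coe_le_coe]
    simpa using h0
  rw [h]
  refine hpS.trans ?_
  rw [hv S, hv univ]
  exact Finset.sum_le_sum_of_subset (Finset.subset_univ S)

/-- The revenue from a type that is a function of a uniform parameter is the average payment. -/
theorem revenue_map_uniform {n : ℕ} {Ω : Type*} [Fintype Ω] [Nonempty Ω] (f : Ω → SetValuation n)
    (p : Pricing n) :
    revenue p ((PMF.uniformOfFintype Ω).map f) =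
      (Fintype.card Ω : ℝ≥0∞)⁻¹ * ∑ ω, (payment p (f ω) : ℝ≥0∞) := by
  classical
  simp only [revenue, PMF.map_apply, ← ENNReal.tsum_mul_right]
  rw [ENNReal.tsum_comm, tsum_fintype, Finset.mul_sum]
  refine Finset.sum_congr rfl fun ω _ => ?_
  rw [tsum_eq_single (f ω) fun v hv => by simp [hv]]
  simp

/-! ### The ordered equal-revenue types -/

/-- The value `2⁻ˡ / (1 + (ω + l))` of level `l` for the type `ω`, where `ω + l` is taken
modulo `L`. -/
noncomputable def levelValue {L : ℕ} (ω l : Fin L) : ℝ≥0 :=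
  (2 ^ (l : ℕ))⁻¹ * (((ω + l : Fin L) : ℕ) + 1 : ℝ≥0)⁻¹

/-- The levels `l` with `r < 2 ^ (l + 1)`, where `r = i.rev + 1` is the rank of the item `i` counted
from the last item. -/
def levels (L : ℕ) {n : ℕ} (i : Fin n) : Finset (Fin L) :=
  {l : Fin L | (i.rev : ℕ) + 1 < 2 ^ ((l : ℕ) + 1)}

theorem mem_levels {n L : ℕ} {i : Fin n} {l : Fin L} :
    l ∈ levels L i ↔ (i.rev : ℕ) + 1 < 2 ^ ((l : ℕ) + 1) := by
  simp only [levels, Finset.mem_filter, Finset.mem_univ, true_and]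

/-- The value of item `i` for the type `ω`: the maximum of the level values over the levels of `i`.
It is `0` if there is no such level. -/
noncomputable def itemValue {n L : ℕ} (ω : Fin L) (i : Fin n) : ℝ≥0 :=
  (levels L i).sup (levelValue ω)

/-- The additive valuation of the type `ω`. -/
noncomputable def typeValuation (n : ℕ) {L : ℕ} (ω : Fin L) : SetValuation n :=
  fun S => ∑ i ∈ S, itemValue ω i

theorem typeValuation_singleton {n L : ℕ} (ω : Fin L) (i : Fin n) :
    typeValuation n ω {i} = itemValue ω i := by
  simp [typeValuation]

theorem isAdditive_typeValuation (n : ℕ) {L : ℕ} (ω : Fin L) :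
    IsAdditive (typeValuation n ω) := fun S => by
  simp only [typeValuation_singleton]
  rfl

theorem hasOrderedValues_typeValuation (n : ℕ) {L : ℕ} (ω : Fin L) :
    HasOrderedValues (typeValuation n ω) := by
  intro i j hij
  rw [typeValuation_singleton, typeValuation_singleton]
  refine Finset.sup_mono fun l hl => ?_
  rw [mem_levels] at hl ⊢
  have : (j.rev : ℕ) ≤ i.rev := Fin.rev_le_rev.mpr hij
  omega

/-- The distribution of the types. -/
noncomputable def typeDistribution (n L : ℕ) [NeZero L] : PMF (SetValuation n) :=
  (PMF.uniformOfFintype (Fin L)).map (typeValuation n)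

theorem support_typeDistribution (n L : ℕ) [NeZero L] :
    (typeDistribution n L).support = Set.range (typeValuation n (L := L)) := by
  simp [typeDistribution]

theorem revenue_typeDistribution {n L : ℕ} [NeZero L] (p : Pricing n) :
    revenue p (typeDistribution n L) =
      (L : ℝ≥0∞)⁻¹ * ∑ ω : Fin L, (payment p (typeValuation n ω) : ℝ≥0∞) := by
  rw [typeDistribution, revenue_map_uniform, Fintype.card_fin]

/-! ### The revenue from the grand bundle -/

/-- Summation by dyadic blocks of ranks. -/
theorem sum_range_log_two (g : ℕ → ℝ≥0) (L : ℕ) :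
    ∑ j ∈ range (2 ^ L - 1), g (Nat.log 2 (j + 1)) = ∑ l ∈ range L, 2 ^ l * g l := by
  induction L with
  | zero => simp
  | succ L ih =>
    have hpos : 1 ≤ 2 ^ L := Nat.one_le_two_pow
    have hsplit : 2 ^ (L + 1) - 1 = (2 ^ L - 1) + 2 ^ L := by
      rw [pow_succ]
      omega
    rw [hsplit, Finset.sum_range_add, ih, Finset.sum_range_succ]
    congr 1
    rw [Finset.sum_congr rfl (g := fun _ => g L), Finset.sum_const, Finset.card_range, nsmul_eq_mul]
    · norm_cast
    · intro x hx
      rw [Finset.mem_range] at hx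
      rw [Nat.log_eq_of_pow_le_of_lt_pow (m := L) (by omega) (by rw [pow_succ]; omega)]

/-- Every type values the grand bundle at least at the `L`-th harmonic number. -/
theorem harmonic_le_sum_itemValue {n L : ℕ} [NeZero L] (hL : 2 ^ L ≤ n) (ω : Fin L) :
    ∑ k : Fin L, ((k : ℕ) + 1 : ℝ≥0)⁻¹ ≤ ∑ i : Fin n, itemValue ω i := by
  set g : ℕ → ℝ≥0 := fun l => if h : l < L then levelValue ω ⟨l, h⟩ else 0 with hg
  have hitem (i : Fin n) : g (Nat.log 2 ((i.rev : ℕ) + 1)) ≤ itemValue ω i := by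
    simp only [hg]
    split_ifs with h
    · refine Finset.le_sup (f := levelValue ω) ?_
      exact mem_levels.mpr (Nat.lt_pow_succ_log_self one_lt_two ((i.rev : ℕ) + 1))
    · exact zero_le
  calc ∑ k : Fin L, ((k : ℕ) + 1 : ℝ≥0)⁻¹
      = ∑ l : Fin L, (((ω + l : Fin L) : ℕ) + 1 : ℝ≥0)⁻¹ :=
        (Equiv.sum_comp (Equiv.addLeft ω) fun k : Fin L => ((k : ℕ) + 1 : ℝ≥0)⁻¹).symm
    _ = ∑ l : Fin L, 2 ^ (l : ℕ) * g l := by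
        refine Finset.sum_congr rfl fun l _ => ?_
        simp only [hg, l.isLt, dif_pos, levelValue, Fin.eta]
        rw [mul_inv_cancel_left₀ (by positivity)]
    _ = ∑ j ∈ range (2 ^ L - 1), g (Nat.log 2 (j + 1)) := by
        rw [sum_range_log_two, Fin.sum_univ_eq_sum_range fun l => 2 ^ l * g l]
    _ ≤ ∑ j ∈ range n, g (Nat.log 2 (j + 1)) :=
        Finset.sum_le_sum_of_subset (Finset.range_mono (by omega))
    _ = ∑ i : Fin n, g (Nat.log 2 ((i.rev : ℕ) + 1)) := by
        rw [← Fin.sum_univ_eq_sum_range fun j => g (Nat.log 2 (j + 1))]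
        exact (Equiv.sum_comp Fin.revPerm fun i : Fin n => g (Nat.log 2 ((i : ℕ) + 1))).symm
    _ ≤ ∑ i : Fin n, itemValue ω i := Finset.sum_le_sum fun i _ => hitem i

theorem harmonic_le_buyManyRev {n L : ℕ} [NeZero L] (hL : 2 ^ L ≤ n) :
    ((∑ k : Fin L, ((k : ℕ) + 1 : ℝ≥0)⁻¹ : ℝ≥0) : ℝ≥0∞) ≤ buyManyRev (typeDistribution n L) := by
  set P : ℝ≥0 := ∑ k : Fin L, ((k : ℕ) + 1 : ℝ≥0)⁻¹
  refine le_iSup₂_of_le (bundlePricing n P) (isBuyManyPricing_bundlePricing n P) ?_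
  rw [revenue_typeDistribution]
  have hn : 0 < n := lt_of_lt_of_le (by positivity) hL
  have hL0 : (L : ℝ≥0∞) ≠ 0 := by exact_mod_cast NeZero.ne L
  calc (P : ℝ≥0∞) = (L : ℝ≥0∞)⁻¹ * ∑ _ω : Fin L, (P : ℝ≥0∞) := by
        rw [Finset.sum_const, Finset.card_univ, Fintype.card_fin, nsmul_eq_mul, ← mul_assoc,
          ENNReal.inv_mul_cancel hL0 (ENNReal.natCast_ne_top L), one_mul]
    _ ≤ _ := by
        gcongr with ω
        exact le_payment_bundlePricing hn (isAdditive_typeValuation n ω)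
          (harmonic_le_sum_itemValue hL ω)

theorem buyManyRev_typeDistribution_lt_top (n L : ℕ) [NeZero L] :
    buyManyRev (typeDistribution n L) < ⊤ := by
  refine lt_of_le_of_lt (b := (L : ℝ≥0∞)⁻¹ * ∑ ω : Fin L, (typeValuation n ω univ : ℝ≥0∞))
    (iSup₂_le fun p hp => ?_) ?_
  · rw [revenue_typeDistribution]
    gcongr with ω
    exact payment_le_value hp.empty (isAdditive_typeValuation n ω)
  · refine ENNReal.mul_lt_top ?_ (ENNReal.sum_lt_top.mpr fun ω _ => ENNReal.coe_lt_top)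
    exact ENNReal.inv_lt_top.mpr (by exact_mod_cast NeZero.pos L)

/-! ### The revenue from item pricings -/

/-- The equal-revenue property of the values `a / (k + 1)`, `k` uniform in `Fin L`. -/
theorem mul_card_le_of_le_mul_inv {L : ℕ} (q a : ℝ≥0) :
    q * #{k : Fin L | q ≤ a * ((k : ℕ) + 1 : ℝ≥0)⁻¹} ≤ a := by
  set S : Finset (Fin L) := {k : Fin L | q ≤ a * ((k : ℕ) + 1 : ℝ≥0)⁻¹}
  rcases S.eq_empty_or_nonempty with hS | hS
  · simp [hS]
  · -- The members of `S` are at most its maximum `m`, so there are at most `m + 1` of them.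
    have hm : q ≤ a * ((S.max' hS : ℕ) + 1 : ℝ≥0)⁻¹ :=
      (Finset.mem_filter.mp (S.max'_mem hS)).2
    have hcard : #S ≤ (S.max' hS : ℕ) + 1 := by
      rw [← Fin.card_Iic]
      exact Finset.card_le_card fun k hk => Finset.mem_Iic.mpr (S.le_max' k hk)
    calc q * #S ≤ a * ((S.max' hS : ℕ) + 1 : ℝ≥0)⁻¹ * ((S.max' hS : ℕ) + 1 : ℝ≥0) := by
          gcongr
          exact_mod_cast hcard
      _ = a := inv_mul_cancel_right₀ (by positivity) a

theorem mul_card_levelValue_le {L : ℕ} [NeZero L] (q : ℝ≥0) (l : Fin L) :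
    q * #{ω : Fin L | q ≤ levelValue ω l} ≤ (2 ^ (l : ℕ))⁻¹ := by
  refine le_trans (le_of_eq ?_) (mul_card_le_of_le_mul_inv (L := L) q (2 ^ (l : ℕ))⁻¹)
  congr 2
  exact Finset.card_equiv (Equiv.addRight l) fun ω => by
    rw [Finset.mem_filter, Finset.mem_filter]
    simp only [Finset.mem_univ, true_and, levelValue, Equiv.coe_addRight]

/-- A union bound over the levels that contribute to item `i`. -/
theorem mul_card_itemValue_le {n L : ℕ} [NeZero L] (q : ℝ≥0) (i : Fin n) :
    q * #{ω : Fin L | q ≤ itemValue ω i} ≤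
      ∑ l ∈ levels L i, (2 ^ (l : ℕ))⁻¹ := by
  classical
  rcases eq_or_ne q 0 with rfl | hq
  · simp
  have hsub : ({ω : Fin L | q ≤ itemValue ω i} : Finset (Fin L)) ⊆
      (levels L i).biUnion fun l => {ω : Fin L | q ≤ levelValue ω l} := by
    intro ω hω
    have hω' : q ≤ (levels L i).sup (levelValue ω) := (Finset.mem_filter.mp hω).2
    -- As `q` is positive, it is below a maximum only if it is below one of its terms.
    obtain ⟨l, hl, hql⟩ := (Finset.le_sup_iff (pos_iff_ne_zero.mpr hq)).mp hω'
    exact Finset.mem_biUnion.mpr ⟨l, hl, by simpa using hql⟩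
  calc q * #{ω : Fin L | q ≤ itemValue ω i}
      ≤ q * ((∑ l ∈ levels L i, #{ω : Fin L | q ≤ levelValue ω l} : ℕ) : ℝ≥0) := by
        gcongr
        exact (Finset.card_le_card hsub).trans Finset.card_biUnion_le
    _ = ∑ l ∈ levels L i, q * #{ω : Fin L | q ≤ levelValue ω l} := by
        rw [Nat.cast_sum, Finset.mul_sum]
    _ ≤ ∑ l ∈ levels L i, (2 ^ (l : ℕ))⁻¹ := Finset.sum_le_sum fun l _ => mul_card_levelValue_le q l

theorem card_rank_lt_le (n m : ℕ) : #{i : Fin n | (i.rev : ℕ) + 1 < m} ≤ m := by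
  calc #{i : Fin n | (i.rev : ℕ) + 1 < m} ≤ #(range m) :=
        Finset.card_le_card_of_injOn (fun i => (i.rev : ℕ))
          (fun i hi => by
            have : (i.rev : ℕ) + 1 < m := by simpa using hi
            simp only [Finset.coe_range, Set.mem_Iio]
            omega)
          (fun i _ j _ h => Fin.rev_injective (Fin.ext h))
    _ = m := Finset.card_range m

theorem sum_payment_itemPricing_le {n L : ℕ} [NeZero L] (q : Fin n → ℝ≥0) :
    ∑ ω : Fin L, payment (fun S => ∑ i ∈ S, q i) (typeValuation n ω) ≤ L * 2 := by
  calc ∑ ω : Fin L, payment (fun S => ∑ i ∈ S, q i) (typeValuation n ω)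
      = ∑ i : Fin n, q i * #{ω : Fin L | q i ≤ itemValue ω i} := by
        simp only [payment_of_additive (isAdditive_typeValuation n _), typeValuation_singleton,
          Finset.sum_filter]
        rw [Finset.sum_comm]
        refine Finset.sum_congr rfl fun i _ => ?_
        rw [← Finset.sum_filter, Finset.sum_const, nsmul_eq_mul, mul_comm]
    _ ≤ ∑ i : Fin n, ∑ l ∈ levels L i, (2 ^ (l : ℕ))⁻¹ :=
        Finset.sum_le_sum fun i _ => mul_card_itemValue_le (q i) i
    _ = ∑ l : Fin L, (#{i : Fin n | (i.rev : ℕ) + 1 < 2 ^ ((l : ℕ) + 1)} : ℝ≥0) *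
          (2 ^ (l : ℕ))⁻¹ := by
        simp only [levels, Finset.sum_filter]
        rw [Finset.sum_comm]
        refine Finset.sum_congr rfl fun l _ => ?_
        rw [← Finset.sum_filter, Finset.sum_const, nsmul_eq_mul]
    _ ≤ ∑ _l : Fin L, 2 := by
        refine Finset.sum_le_sum fun l _ => ?_
        calc (#{i : Fin n | (i.rev : ℕ) + 1 < 2 ^ ((l : ℕ) + 1)} : ℝ≥0) * (2 ^ (l : ℕ))⁻¹
            ≤ (2 ^ ((l : ℕ) + 1) : ℕ) * (2 ^ (l : ℕ))⁻¹ := by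
              gcongr
              exact card_rank_lt_le n _
          _ = 2 := by
              push_cast
              rw [pow_succ']
              exact mul_inv_cancel_right₀ (by positivity) 2
    _ = L * 2 := by simp

theorem itemRev_le_two (n L : ℕ) [NeZero L] : itemRev (typeDistribution n L) ≤ 2 := by
  refine iSup₂_le fun p hp => ?_
  obtain ⟨q, hq⟩ := hp
  obtain rfl : p = fun S => ∑ i ∈ S, q i := funext hq
  have hL0 : (L : ℝ≥0∞) ≠ 0 := by exact_mod_cast NeZero.ne L
  rw [revenue_typeDistribution]
  calc (L : ℝ≥0∞)⁻¹ *
        ∑ ω : Fin L, (payment (fun S => ∑ i ∈ S, q i) (typeValuation n ω) : ℝ≥0∞)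
      ≤ (L : ℝ≥0∞)⁻¹ * (L * 2) := by
        gcongr
        exact_mod_cast sum_payment_itemPricing_le q
    _ = 2 := by
        rw [← mul_assoc, ENNReal.inv_mul_cancel hL0 (ENNReal.natCast_ne_top L), one_mul]

/-- Pricing the items at the values of the type `0` extracts the whole positive value of that
type. -/
theorem itemRev_typeDistribution_pos {n L : ℕ} [NeZero L] (hL : 2 ^ L ≤ n) :
    0 < itemRev (typeDistribution n L) := by
  refine lt_of_lt_of_le ?_ (le_iSup₂_of_le (fun S => ∑ i ∈ S, itemValue (0 : Fin L) i)
    ⟨_, fun _ => rfl⟩ le_rfl)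
  rw [revenue_typeDistribution]
  refine ENNReal.mul_pos (ENNReal.inv_ne_zero.mpr (ENNReal.natCast_ne_top L)) (ne_of_gt ?_)
  refine lt_of_lt_of_le ?_ (Finset.single_le_sum (fun _ _ => zero_le) (Finset.mem_univ (0 : Fin L)))
  rw [payment_of_additive (isAdditive_typeValuation n _)]
  simp only [typeValuation_singleton, le_refl, Finset.filter_true, ENNReal.coe_pos]
  refine lt_of_lt_of_le ?_ (harmonic_le_sum_itemValue hL 0)
  exact Finset.sum_pos (fun k _ => by positivity) Finset.univ_nonempty

/-! ### Comparison -/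

theorem log_log_le_harmonic {n : ℕ} (hn : 3 ≤ n) :
    Real.log (Real.log n) ≤ ((∑ k : Fin (Nat.log 2 n), ((k : ℕ) + 1 : ℝ≥0)⁻¹ : ℝ≥0) : ℝ) := by
  set L := Nat.log 2 n
  have hn3 : (3 : ℝ) ≤ n := by exact_mod_cast hn
  have hpow : (n : ℝ) ≤ 2 ^ (L + 1) := by
    exact_mod_cast (Nat.lt_pow_succ_log_self one_lt_two n).le
  have hlog : Real.log n ≤ L + 1 := by
    calc Real.log n ≤ Real.log (2 ^ (L + 1)) := Real.log_le_log (by linarith) hpow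
      _ = (L + 1) * Real.log 2 := by rw [Real.log_pow]; push_cast; rfl
      _ ≤ (L + 1) * 1 := by
          gcongr
          linarith [Real.log_two_lt_d9]
      _ = L + 1 := mul_one _
  calc Real.log (Real.log n) ≤ Real.log (L + 1 : ℕ) := by
        push_cast
        exact Real.log_le_log (Real.log_pos (by linarith)) hlog
    _ ≤ harmonic L := log_add_one_le_harmonic L
    _ = _ := by
        rw [harmonic]
        push_cast
        rw [Fin.sum_univ_eq_sum_range fun k => ((k : ℝ) + 1)⁻¹]

end BuyMany

theorem mainTheorem6 :
    ∃ c : ℝ, 0 < c ∧ ∀ n : ℕ, 3 ≤ n →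
      ∃ D : PMF (BuyMany.SetValuation n),
        D.support.Finite ∧
        (∀ v ∈ D.support, BuyMany.IsAdditive v ∧ BuyMany.HasOrderedValues v) ∧
        0 < BuyMany.itemRev D ∧
        BuyMany.buyManyRev D < ⊤ ∧
        ENNReal.ofReal (c * Real.log (Real.log n)) * BuyMany.itemRev D ≤
          BuyMany.buyManyRev D := by
  refine ⟨1 / 2, by norm_num, fun n hn => ?_⟩
  have hL : 2 ^ Nat.log 2 n ≤ n := Nat.pow_log_le_self 2 (by omega)
  have : NeZero (Nat.log 2 n) := ⟨(Nat.log_pos one_lt_two (by omega)).ne'⟩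
  refine ⟨BuyMany.typeDistribution n (Nat.log 2 n), ?_, ?_,
    BuyMany.itemRev_typeDistribution_pos hL,
    BuyMany.buyManyRev_typeDistribution_lt_top n _, ?_⟩
  · rw [BuyMany.support_typeDistribution]
    exact Set.finite_range _
  · rw [BuyMany.support_typeDistribution]
    rintro _ ⟨ω, rfl⟩
    exact ⟨BuyMany.isAdditive_typeValuation n ω, BuyMany.hasOrderedValues_typeValuation n ω⟩
  · calc ENNReal.ofReal (1 / 2 * Real.log (Real.log n)) *
          BuyMany.itemRev (BuyMany.typeDistribution n (Nat.log 2 n))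
        ≤ ENNReal.ofReal (1 / 2 * Real.log (Real.log n)) * ENNReal.ofReal 2 := by
          gcongr
          exact (BuyMany.itemRev_le_two n _).trans_eq (by simp)
      _ = ENNReal.ofReal (Real.log (Real.log n)) := by
          rw [← ENNReal.ofReal_mul' zero_le_two]
          congr 1
          ring
      _ ≤ _ := (ENNReal.ofReal_le_ofReal (BuyMany.log_log_le_harmonic hn)).trans_eq
          (ENNReal.ofReal_coe_nnreal)
      _ ≤ _ := BuyMany.harmonic_le_buyManyRev hL
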